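/- Let $0<\alpha<2$, and let $S_\alpha(\sigma,0,0)$ denote the symmetric $\alpha$-stable law on $\mathbb{R}$ with characteristic function $u\mapsto e^{-\sigma^\alpha|u|^\alpha}$. Let $M$ be a symmetric $\alpha$-stable random measure on $\mathbb{R}$ with control measure Lebesgue measure $\mathcal{L}$, that is, a random set function on the Borel sets of finite Lebesgue measure which takes independent values on disjoint sets, is almost surely $\sigma$-additive, and satisfies $M(A)\sim S_\alpha(\mathcal{L}(A)^{1/\alpha},0,0)$. Let $g:\mathbb{R}\to\mathbb{R}$ be measurable with $\int|g(x)|^\alpha\,dx<\infty$, and let $$Y(t)=\int g(t-x)\,M(dx)\qquad(t\in\mathbb{R})$$ be the corresponding moving average process, where $\int f\,dM$ is the limit in probability of the integrals of simple functions, with supports of finite measure, converging to $f$ in $L^\alpha(\mathbb{R})$. Suppose that there are constants $c>0$ and $\lambda>1$ such that, for all sufficiently small $|h|$, $$\int|g(h-x)-g(-x)|^\alpha\,dx\le c\,|h|^\lambda .$$ Then $Y$ has a continuous version $Z$ (that is, $P(Z(t)=Y(t))=1$ for every $t\in\mathbb{R}$, and every path of $Z$ is continuous) such that, for every $0\le\theta<(\lambda-1)/\alpha$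 and every bounded interval $[a,b]$, each path of $Z$ satisfies a $\theta$-Hölder condition on $[a,b]$: $|Z(t)-Z(s)|\le C|t-s|^\theta$ for all $s,t\in[a,b]$, where the finite constant $C$ may depend on the path, on $\theta$ and on $[a,b]$. -/

import Mathlib

open MeasureTheory ProbabilityTheory Filter Topology
open scoped ENNReal NNReal

/-- `μ` is the symmetric `α`-stable law `S_α(σ, 0, 0)` with scale `σ`, given by its
characteristic function `u ↦ exp (-σ ^ α |u| ^ α)`. -/
def IsSymStableLaw (α σ : ℝ) (μ : Measure ℝ) : Prop :=
  ∀ u : ℝ, charFun μ u = ((Real.exp (-(σ ^ α * |u| ^ α)) : ℝ) : ℂ)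

/-- `M` is a symmetric `α`-stable random measure on `E` with control measure `m`: a random set
function on the measurable sets of finite `m`-measure (its values on other sets are irrelevant)
which is independently scattered, almost surely `σ`-additive, and such that
`M A` has law `S_α(m(A) ^ (1 / α), 0, 0)`.
The series `∑ M (A i)` is the limit of its partial sums; it need not converge absolutely. -/
structure IsSymStableRandomMeasure {E Ω : Type*} [MeasurableSpace E] [MeasurableSpace Ω]
    (α : ℝ) (m : Measure E) (P : Measure Ω) (M : Set E → Ω → ℝ) : Prop where
  measurable : ∀ A : Set E, MeasurableSet A → m A < ∞ → Measurable (M A)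
  law : ∀ A : Set E, MeasurableSet A → m A < ∞ →
    IsSymStableLaw α ((m A).toReal ^ (1 / α)) (P.map (M A))
  indep : ∀ (n : ℕ) (A : Fin n → Set E), (∀ i, MeasurableSet (A i)) → (∀ i, m (A i) < ∞) →
    (∀ i j, i ≠ j → Disjoint (A i) (A j)) → iIndepFun (fun i => M (A i)) P
  sigma_additive : ∀ A : ℕ → Set E, (∀ i, MeasurableSet (A i)) → m (⋃ i, A i) < ∞ →
    (∀ i j, i ≠ j → Disjoint (A i) (A j)) →
    ∀ᵐ ω ∂P, Tendsto (fun n => ∑ i ∈ Finset.range n, M (A i) ω) atTop (𝓝 (M (⋃ i, A i) ω))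

/-- The integral `∑ c · M {f = c}` of a simple function; the value `c = 0` contributes nothing,
so only sets of finite measure matter when `f` has a support of finite measure. -/
noncomputable def simpleStableIntegral {E Ω : Type*} [MeasurableSpace E]
    (M : Set E → Ω → ℝ) (f : SimpleFunc E ℝ) (ω : Ω) : ℝ :=
  ∑ c ∈ f.range, c * M (f ⁻¹' {c}) ω

/-- The random variable `X` is (a version of) the stochastic integral `∫ f dM`: the limit in
probability of the integrals of simple functions, with supports of finite measure, that converge
to `f` in the `L^α` (quasi-)norm. -/
def IsStableIntegral {E Ω : Type*} [MeasurableSpace E] [MeasurableSpace Ω]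
    (α : ℝ) (m : Measure E) (P : Measure Ω) (M : Set E → Ω → ℝ) (f : E → ℝ) (X : Ω → ℝ) : Prop :=
  Measurable X ∧
    ∃ F : ℕ → SimpleFunc E ℝ, (∀ n, (F n).FinMeasSupp m) ∧
      Tendsto (fun n => eLpNorm (fun x => F n x - f x) (ENNReal.ofReal α) m) atTop (𝓝 0) ∧
      TendstoInMeasure P (fun n => simpleStableIntegral M (F n)) atTop X

/-- `Y` is the moving average process `Y(t) = ∫ g(t - x) M(dx)`, `t ∈ ℝ`, the control measure of
`M` being Lebesgue measure. -/
def IsStableMovingAverage {Ω : Type*} [MeasurableSpace Ω]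
    (α : ℝ) (P : Measure Ω) (M : Set ℝ → Ω → ℝ) (g : ℝ → ℝ) (Y : ℝ → Ω → ℝ) : Prop :=
  ∀ t : ℝ, IsStableIntegral α volume P M (fun x => g (t - x)) (Y t)

/-! For simple `F` and `G`, refining to a common partition writes the difference of their integrals
as a sum of independent stable variables, again stable, with `σ ^ α = ∫ |F - G| ^ α`. Its
characteristic function controls its tail by a multiple of `σ ^ α * r ^ (-α)`, and this survives the
limit in probability. Translation invariance of Lebesgue measure and the hypothesis on `g` then give
`P (|Y t - Y s| > r) ≤ K |t - s| ^ lam * r ^ (-α)` for close `s, t`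
(`exists_hasIncrementTailBound`).

This is Kolmogorov's criterion in weak form. The `α`-th moment of a nondegenerate stable law is
infinite, but Kolmogorov's argument uses moments only through such tail bounds. About `2 ^ n` dyadic
increments of level `n`, tested against `2 ^ (-n θ)`, fail with total probability of order `2 ^ (n
(1 - lam + θ α))`, summable when `θ < (lam - 1) / α`. Borel–Cantelli and chaining give Hölder limits
along dyadics (`exists_holder_modification`). -/

namespace IsSymStableRandomMeasure

/-! ### Finite additivity and characteristic functions of simple integrals. -/

variable {E Ω : Type*} [MeasurableSpace E] [MeasurableSpace Ω] {α : ℝ} {m : Measure E}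
  {P : Measure Ω} {M : Set E → Ω → ℝ}

lemma ae_empty (hM : IsSymStableRandomMeasure α m P M) : ∀ᵐ ω ∂P, M ∅ ω = 0 := by
  have h := hM.sigma_additive (fun _ => ∅) (by simp) (by simp) (by simp)
  filter_upwards [h] with ω hω
  simp only [Set.iUnion_empty, Finset.sum_const, Finset.card_range, nsmul_eq_mul] at hω
  -- Consecutive partial sums `n * M ∅ ω` differ by `M ∅ ω`, so convergence forces it to vanish.
  have h1 := (tendsto_add_atTop_iff_nat 1).2 hω
  have h2 := h1.sub hω
  simp only [Nat.cast_add, Nat.cast_one, add_mul, one_mul, add_sub_cancel_left, sub_self] at h2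
  exact tendsto_nhds_unique tendsto_const_nhds h2

lemma ae_union (hM : IsSymStableRandomMeasure α m P M) {A B : Set E} (hA : MeasurableSet A)
    (hB : MeasurableSet B) (hmA : m A < ∞) (hmB : m B < ∞) (hAB : Disjoint A B) :
    ∀ᵐ ω ∂P, M (A ∪ B) ω = M A ω + M B ω := by
  let C : ℕ → Set E := fun n => if n = 0 then A else if n = 1 then B else ∅
  have hU : ⋃ i, C i = A ∪ B := by
    ext x
    simp only [Set.mem_iUnion, Set.mem_union]
    constructor
    · rintro ⟨i, hi⟩
      by_cases h0 : i = 0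
      · left; simpa [C, h0] using hi
      by_cases h1 : i = 1
      · right; simpa [C, h1] using hi
      · simp [C, h0, h1] at hi
    · rintro (h | h)
      · exact ⟨0, by simpa [C] using h⟩
      · exact ⟨1, by simpa [C] using h⟩
  have h := hM.sigma_additive C
    (fun i => by simp only [C]; split_ifs <;> simp [hA, hB])
    (hU ▸ measure_union_lt_top hmA hmB)
    (fun i j hij => by
      simp only [C]
      split_ifs <;> first | omega | simp [hAB.symm])
  filter_upwards [h, hM.ae_empty] with ω hω h0
  rw [hU] at hω
  refine tendsto_nhds_unique hω (tendsto_const_nhds.congr' ?_)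
  filter_upwards [eventually_ge_atTop 2] with n hn
  obtain ⟨k, rfl⟩ := Nat.exists_eq_add_of_le hn
  rw [Finset.sum_range_add]
  simp [Finset.sum_range_succ, C, h0, show ∀ i, 2 + i ≠ 1 by intro i; omega]

lemma ae_biUnion_finset (hM : IsSymStableRandomMeasure α m P M) {ι : Type*} (s : Finset ι)
    (A : ι → Set E) (hA : ∀ i ∈ s, MeasurableSet (A i)) (hm : ∀ i ∈ s, m (A i) < ∞)
    (hd : (s : Set ι).PairwiseDisjoint A) :
    ∀ᵐ ω ∂P, M (⋃ i ∈ s, A i) ω = ∑ i ∈ s, M (A i) ω := by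
  classical
  induction s using Finset.induction_on with
  | empty => simpa using hM.ae_empty
  | insert a s ha ih =>
    have hA' : ∀ i ∈ s, MeasurableSet (A i) := fun i hi => hA i (Finset.mem_insert_of_mem hi)
    have hm' : ∀ i ∈ s, m (A i) < ∞ := fun i hi => hm i (Finset.mem_insert_of_mem hi)
    have h1 := ih hA' hm' (hd.subset (by simp))
    have h2 := hM.ae_union (hA a (by simp)) (Finset.measurableSet_biUnion s hA')
      (hm a (by simp)) (measure_biUnion_lt_top s.finite_toSet hm') (by
        rw [Set.disjoint_iUnion₂_right]
        intro i hi
        exact hd (by simp) (by simp [hi]) (fun h => ha (h ▸ hi)))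
    filter_upwards [h1, h2] with ω h1 h2
    rw [Finset.set_biUnion_insert, h2, h1, Finset.sum_insert ha]

/-- Allows the integral to be computed on a finer partition; applied to `F.pair G`, it puts two
simple integrals on the same sets. -/
lemma simpleStableIntegral_map (hM : IsSymStableRandomMeasure α m P M) {β : Type*}
    (H : SimpleFunc E β) (φ : β → ℝ) (hH : ∀ p, φ p ≠ 0 → m (H ⁻¹' {p}) < ∞) :
    ∀ᵐ ω ∂P, simpleStableIntegral M (H.map φ) ω = ∑ p ∈ H.range, φ p * M (H ⁻¹' {p}) ω := by
  classical
  have key : ∀ c ∈ (H.map φ).range, ∀ᵐ ω ∂P, c * M (H.map φ ⁻¹' {c}) ω =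
      ∑ p ∈ H.range with φ p = c, φ p * M (H ⁻¹' {p}) ω := by
    intro c _
    by_cases hc : c = 0
    · filter_upwards with ω
      rw [hc, zero_mul]
      refine (Finset.sum_eq_zero fun p hp => ?_).symm
      rw [(Finset.mem_filter.1 hp).2, zero_mul]
    · have hfib : H.map φ ⁻¹' {c} = ⋃ p ∈ H.range.filter (fun p => φ p = c), H ⁻¹' {p} := by
        ext x; simp
      have := hM.ae_biUnion_finset (H.range.filter (fun p => φ p = c)) (fun p => H ⁻¹' {p})
        (fun p _ => H.measurableSet_fiber p)
        (fun p hp => hH p (by rw [(Finset.mem_filter.1 hp).2]; exact hc))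
        (fun p _ q _ hpq => Disjoint.preimage _ (by simpa using hpq))
      filter_upwards [this] with ω hω
      rw [hfib, hω, Finset.mul_sum]
      exact Finset.sum_congr rfl fun p hp => by rw [(Finset.mem_filter.1 hp).2]
  have hall := (ae_ball_iff (Finset.countable_toSet (H.map φ).range)).2 key
  filter_upwards [hall] with ω hω
  rw [simpleStableIntegral, Finset.sum_congr rfl hω]
  exact Finset.sum_fiberwise_of_maps_to (fun p hp => by
    rw [SimpleFunc.range_map]; exact Finset.mem_image_of_mem _ hp) _

lemma charFun_sum (hM : IsSymStableRandomMeasure α m P M) (hα : 0 < α) {ι : Type*}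
    (s : Finset ι) (A : ι → Set E) (c : ι → ℝ) (hA : ∀ i ∈ s, MeasurableSet (A i))
    (hm : ∀ i ∈ s, m (A i) < ∞) (hd : (s : Set ι).PairwiseDisjoint A) (u : ℝ) :
    charFun (P.map fun ω => ∑ i ∈ s, c i * M (A i) ω) u =
      ((Real.exp (-((∑ i ∈ s, |c i| ^ α * (m (A i)).toReal) * |u| ^ α)) : ℝ) : ℂ) := by
  classical
  let e := s.equivFin
  have hsum : ∀ f : ι → ℝ, ∑ i ∈ s, f i = ∑ k : Fin s.card, f (e.symm k) := fun f => by
    rw [← Finset.sum_coe_sort]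
    exact (Equiv.sum_comp e.symm (fun i : s => f i)).symm
  have hmeas : ∀ k : Fin s.card, Measurable (M (A (e.symm k))) := fun k =>
    hM.measurable _ (hA _ (e.symm k).2) (hm _ (e.symm k).2)
  have hind := hM.indep s.card (fun k => A (e.symm k)) (fun k => hA _ (e.symm k).2)
    (fun k => hm _ (e.symm k).2) (fun i j hij => hd (e.symm i).2 (e.symm j).2
      (fun h => hij (e.symm.injective (Subtype.ext h))))
  have hind' := hind.comp (fun k x => c (e.symm k) * x) (fun k => by fun_prop)
  simp_rw [hsum]
  have := hind'.charFun_map_fun_sum_eq_prod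
    (fun k => ((hmeas k).const_mul (c (e.symm k))).aemeasurable)
  have h2 := congrFun this u
  rw [h2, Finset.prod_apply, Finset.sum_mul, ← Finset.sum_neg_distrib, Real.exp_sum,
    Complex.ofReal_prod]
  refine Finset.prod_congr rfl fun k _ => ?_
  rw [charFun_map_mul_comp (hmeas k).aemeasurable,
    hM.law _ (hA _ (e.symm k).2) (hm _ (e.symm k).2)]
  congr 3
  rw [← Real.rpow_mul ENNReal.toReal_nonneg, one_div, inv_mul_cancel₀ hα.ne', Real.rpow_one,
    abs_mul, Real.mul_rpow (abs_nonneg _) (abs_nonneg _)]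
  ring

end IsSymStableRandomMeasure

/-! ### Tail bounds for stable integrals. -/

/-- The truncation inequality bounds the tail by an average of `1 - charFun μ` over `|t| ≤ 2 / r`,
where `1 - exp (-x) ≤ x` applies. -/
lemma measureReal_abs_gt_le_of_charFun_eq {μ : Measure ℝ} [IsProbabilityMeasure μ] {α S r : ℝ}
    (hα : 0 < α) (hS : 0 ≤ S) (hr : 0 < r)
    (hμ : ∀ u, charFun μ u = ((Real.exp (-(S * |u| ^ α)) : ℝ) : ℂ)) :
    μ.real {x | r < |x|} ≤ 2 * 2 ^ α * S * r ^ (-α) := by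
  refine (measureReal_abs_gt_le_integral_charFun hr).trans ?_
  have hb : ∀ t ∈ Set.uIoc (-2 * r⁻¹) (2 * r⁻¹), ‖1 - charFun μ t‖ ≤ S * (2 * r⁻¹) ^ α := by
    intro t ht
    have hr' : 0 < r⁻¹ := inv_pos.2 hr
    rw [Set.uIoc_of_le (by linarith)] at ht
    rw [hμ, ← Complex.ofReal_one, ← Complex.ofReal_sub, Complex.norm_real, Real.norm_eq_abs]
    have h0 : 0 ≤ S * |t| ^ α := by positivity
    have h1 : Real.exp (-(S * |t| ^ α)) ≤ 1 := Real.exp_le_one_iff.2 (by linarith)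
    have h2 := Real.add_one_le_exp (-(S * |t| ^ α))
    rw [abs_of_nonneg (by linarith)]
    have h3 : |t| ^ α ≤ (2 * r⁻¹) ^ α :=
      Real.rpow_le_rpow (abs_nonneg _) (abs_le.2 ⟨by linarith [ht.1], ht.2⟩) hα.le
    nlinarith
  have h := intervalIntegral.norm_integral_le_of_norm_le_const hb
  calc 2⁻¹ * r * ‖∫ t in (-2 * r⁻¹)..(2 * r⁻¹), 1 - charFun μ t‖
      ≤ 2⁻¹ * r * (S * (2 * r⁻¹) ^ α * |2 * r⁻¹ - -2 * r⁻¹|) := by gcongr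
    _ = 2 * 2 ^ α * S * r ^ (-α) := by
      rw [show 2 * r⁻¹ - -2 * r⁻¹ = 4 * r⁻¹ by ring, abs_of_pos (by positivity),
        Real.mul_rpow (by norm_num) (by positivity), Real.inv_rpow hr.le, Real.rpow_neg hr.le]
      field_simp
      ring

lemma eLpNorm_ofReal_rpow {E : Type*} [MeasurableSpace E] {m : Measure E} {α : ℝ} (hα : 0 < α)
    (f : E → ℝ) :
    eLpNorm f (ENNReal.ofReal α) m ^ α = ∫⁻ x, ENNReal.ofReal (|f x| ^ α) ∂m := by
  rw [eLpNorm_eq_lintegral_rpow_enorm_toReal (by simpa using hα) ENNReal.ofReal_ne_top,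
    ENNReal.toReal_ofReal hα.le, ← ENNReal.rpow_mul, one_div, inv_mul_cancel₀ hα.ne',
    ENNReal.rpow_one]
  refine lintegral_congr fun x => ?_
  rw [← ENNReal.ofReal_rpow_of_nonneg (abs_nonneg _) hα.le, Real.enorm_eq_ofReal_abs]

section

variable {E Ω : Type*} [MeasurableSpace E] [MeasurableSpace Ω] {α : ℝ} {m : Measure E}
  {P : Measure Ω} [IsProbabilityMeasure P] {M : Set E → Ω → ℝ}

lemma IsSymStableRandomMeasure.measure_abs_simple_sub_gt_le
    (hM : IsSymStableRandomMeasure α m P M) (hα : 0 < α) {F G : SimpleFunc E ℝ}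
    (hF : F.FinMeasSupp m) (hG : G.FinMeasSupp m) {r : ℝ} (hr : 0 < r) :
    P {ω | r < |simpleStableIntegral M F ω - simpleStableIntegral M G ω|} ≤
      ENNReal.ofReal (2 * 2 ^ α * r ^ (-α)) *
        eLpNorm (fun x => F x - G x) (ENNReal.ofReal α) m ^ α := by
  classical
  let H := F.pair G
  have hH1 : ∀ p : ℝ × ℝ, p.1 ≠ 0 → m (H ⁻¹' {p}) < ∞ := fun p hp =>
    (measure_mono (fun x hx => by
      have hx : H x = p := hx
      change F x = p.1
      rw [← hx]; rfl)).trans_lt (hF.meas_preimage_singleton_ne_zero hp)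
  have hH2 : ∀ p : ℝ × ℝ, p.2 ≠ 0 → m (H ⁻¹' {p}) < ∞ := fun p hp =>
    (measure_mono (fun x hx => by
      have hx : H x = p := hx
      change G x = p.2
      rw [← hx]; rfl)).trans_lt (hG.meas_preimage_singleton_ne_zero hp)
  -- Dropping the diagonal removes the fibre over `(0, 0)`, which may have infinite measure.
  set s := H.range.filter (fun p => p.1 ≠ p.2) with hs
  have hfin : ∀ p ∈ s, m (H ⁻¹' {p}) < ∞ := by
    intro p hp
    by_cases h1 : p.1 = 0
    · exact hH2 p (fun h2 => (Finset.mem_filter.1 hp).2 (h1.trans h2.symm))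
    · exact hH1 p h1
  have hrep : ∀ᵐ ω ∂P, simpleStableIntegral M F ω - simpleStableIntegral M G ω =
      ∑ p ∈ s, (p.1 - p.2) * M (H ⁻¹' {p}) ω := by
    filter_upwards [hM.simpleStableIntegral_map H Prod.fst hH1,
      hM.simpleStableIntegral_map H Prod.snd hH2] with ω h1 h2
    rw [SimpleFunc.map_fst_pair] at h1
    rw [SimpleFunc.map_snd_pair] at h2
    rw [h1, h2, ← Finset.sum_sub_distrib, hs, Finset.sum_filter_of_ne]
    · exact Finset.sum_congr rfl fun p _ => by ring
    · intro p _ hp h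
      exact hp (by rw [h, sub_self, zero_mul])
  set X : Ω → ℝ := fun ω => ∑ p ∈ s, (p.1 - p.2) * M (H ⁻¹' {p}) ω with hX
  have hXm : Measurable X := Finset.measurable_fun_sum _ fun p hp =>
    (hM.measurable _ (H.measurableSet_fiber p) (hfin p hp)).const_mul _
  set S : ℝ := ∑ p ∈ s, |p.1 - p.2| ^ α * (m (H ⁻¹' {p})).toReal with hSdef
  have hS : 0 ≤ S := by positivity
  have : IsProbabilityMeasure (P.map X) := Measure.isProbabilityMeasure_map hXm.aemeasurable
  have htail := measureReal_abs_gt_le_of_charFun_eq hα hS hr (μ := P.map X) (fun u =>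
    hM.charFun_sum hα s (fun p => H ⁻¹' {p}) (fun p => p.1 - p.2)
      (fun p _ => H.measurableSet_fiber p) hfin
      (fun p _ q _ hpq => Disjoint.preimage _ (by simpa using hpq)) u)
  have hSE : eLpNorm (fun x => F x - G x) (ENNReal.ofReal α) m ^ α = ENNReal.ofReal S := by
    rw [eLpNorm_ofReal_rpow hα]
    have : (fun x => ENNReal.ofReal (|F x - G x| ^ α)) =
        H.map (fun p => ENNReal.ofReal (|p.1 - p.2| ^ α)) := by
      ext x; rfl
    rw [this, SimpleFunc.lintegral_eq_lintegral, SimpleFunc.map_lintegral, hSdef,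
      ENNReal.ofReal_sum_of_nonneg (fun p _ => by positivity)]
    have hzero : ∀ p ∈ H.range, ENNReal.ofReal (|p.1 - p.2| ^ α) * m (H ⁻¹' {p}) ≠ 0 →
        p.1 ≠ p.2 := fun p _ hp h => hp (by simp [h, Real.zero_rpow hα.ne'])
    rw [← Finset.sum_filter_of_ne hzero, ← hs]
    refine Finset.sum_congr rfl fun p hp => ?_
    rw [ENNReal.ofReal_mul (by positivity), ENNReal.ofReal_toReal (hfin p hp).ne]
  have hev : {ω | r < |simpleStableIntegral M F ω - simpleStableIntegral M G ω|} =ᵐ[P]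
      X ⁻¹' {x | r < |x|} := by
    filter_upwards [hrep] with ω hω
    exact propext (by
      change (r < |_ - _|) ↔ r < |X ω|
      rw [hω])
  rw [measure_congr hev, ← Measure.map_apply hXm (measurableSet_lt measurable_const (by fun_prop)),
    hSE, ← ENNReal.ofReal_mul (by positivity), ← ofReal_measureReal]
  exact ENNReal.ofReal_le_ofReal (htail.trans_eq (by ring))

/-- Half of `r` goes to the simple integrals and a quarter to each approximation error, which
vanishes in the limit. For `α < 1` there is only a quasi-triangle inequality; splitting into three
terms costs `LpAddConst` twice. -/
lemma IsStableIntegral.measure_abs_sub_gt_le (hM : IsSymStableRandomMeasure α m P M) (hα : 0 < α)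
    {f f' : E → ℝ} {X X' : Ω → ℝ} (hf : AEStronglyMeasurable f m)
    (hf' : AEStronglyMeasurable f' m) (hX : IsStableIntegral α m P M f X)
    (hX' : IsStableIntegral α m P M f' X') {r : ℝ} (hr : 0 < r) :
    P {ω | r < |X ω - X' ω|} ≤ ENNReal.ofReal (2 * 2 ^ α * (r / 2) ^ (-α)) *
      (ENNReal.LpAddConst (ENNReal.ofReal α) * (ENNReal.LpAddConst (ENNReal.ofReal α) *
        eLpNorm (fun x => f x - f' x) (ENNReal.ofReal α) m)) ^ α := by
  obtain ⟨-, F, hF, hFf, hFX⟩ := hX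
  obtain ⟨-, G, hG, hGf, hGX⟩ := hX'
  set p := ENNReal.ofReal α with hp
  set L := ENNReal.LpAddConst p with hL
  have hLtop : L ≠ ∞ := (ENNReal.LpAddConst_lt_top p).ne
  set D := eLpNorm (fun x => f x - f' x) p m with hD
  set C := ENNReal.ofReal (2 * 2 ^ α * (r / 2) ^ (-α))
  have hr4 : 0 < ENNReal.ofReal (r / 4) := ENNReal.ofReal_pos.2 (by positivity)
  have hbound : ∀ n, P {ω | r < |X ω - X' ω|} ≤
      C * (L * (eLpNorm (fun x => F n x - f x) p m +
        L * (D + eLpNorm (fun x => G n x - f' x) p m))) ^ α +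
      (P {ω | ENNReal.ofReal (r / 4) ≤ edist (simpleStableIntegral M (F n) ω) (X ω)} +
      P {ω | ENNReal.ofReal (r / 4) ≤ edist (simpleStableIntegral M (G n) ω) (X' ω)}) := by
    intro n
    have hnorm : eLpNorm (fun x => F n x - G n x) p m ≤
        L * (eLpNorm (fun x => F n x - f x) p m +
          L * (D + eLpNorm (fun x => G n x - f' x) p m)) := by
      have hFm : AEStronglyMeasurable (F n) m := (F n).stronglyMeasurable.aestronglyMeasurable
      have hGm : AEStronglyMeasurable (G n) m := (G n).stronglyMeasurable.aestronglyMeasurable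
      have e1 : (fun x => F n x - G n x) =
          (fun x => F n x - f x) + ((fun x => f x - f' x) + fun x => f' x - G n x) := by
        ext x; simp
      rw [e1]
      refine (eLpNorm_add_le' (hFm.sub hf) ((hf.sub hf').add (hf'.sub hGm)) p).trans
        (mul_le_mul' le_rfl (add_le_add le_rfl ?_))
      refine (eLpNorm_add_le' (hf.sub hf') (hf'.sub hGm) p).trans_eq ?_
      congr 2
      exact eLpNorm_sub_comm f' (G n) p m
    calc P {ω | r < |X ω - X' ω|}
        ≤ P ({ω | r / 2 < |simpleStableIntegral M (F n) ω - simpleStableIntegral M (G n) ω|} ∪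
          ({ω | ENNReal.ofReal (r / 4) ≤ edist (simpleStableIntegral M (F n) ω) (X ω)} ∪
          {ω | ENNReal.ofReal (r / 4) ≤ edist (simpleStableIntegral M (G n) ω) (X' ω)})) := by
          refine measure_mono fun ω hω => ?_
          simp only [Set.mem_union, Set.mem_ofPred_eq, edist_dist, Real.dist_eq] at hω ⊢
          rw [ENNReal.ofReal_le_ofReal_iff (abs_nonneg _),
            ENNReal.ofReal_le_ofReal_iff (abs_nonneg _)]
          by_contra! hcon
          obtain ⟨h1, h2, h3⟩ := hcon
          have := abs_sub_le (X ω) (simpleStableIntegral M (F n) ω) (X' ω)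
          have := abs_sub_le (simpleStableIntegral M (F n) ω) (simpleStableIntegral M (G n) ω) (X' ω)
          have := abs_sub_comm (X ω) (simpleStableIntegral M (F n) ω)
          linarith
      _ ≤ _ := (measure_union_le _ _).trans (add_le_add
          ((hM.measure_abs_simple_sub_gt_le hα (hF n) (hG n) (half_pos hr)).trans (by gcongr))
          (measure_union_le _ _))
  refine ge_of_tendsto' (x := atTop) ?_ hbound
  have h1 : Tendsto (fun n => L * (eLpNorm (fun x => F n x - f x) p m +
      L * (D + eLpNorm (fun x => G n x - f' x) p m))) atTop (𝓝 (L * (0 + L * (D + 0)))) :=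
    ENNReal.Tendsto.const_mul (hFf.add
      (ENNReal.Tendsto.const_mul (tendsto_const_nhds.add hGf) (.inr hLtop))) (.inr hLtop)
  have h2 := (ENNReal.Tendsto.const_mul (a := C)
    (((ENNReal.continuous_rpow_const (y := α)).tendsto _).comp h1)
    (.inr ENNReal.ofReal_ne_top)).add ((hFX _ hr4).add (hGX _ hr4))
  simpa using h2

end

/-! ### Dyadic chaining. -/

/-- The largest dyadic number of level `n` that is at most `t`. -/
noncomputable def dyadicFloor (n : ℕ) (t : ℝ) : ℝ := (⌊2 ^ n * t⌋ : ℝ) / 2 ^ n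

lemma abs_sub_dyadicFloor_le (n : ℕ) (t : ℝ) : |t - dyadicFloor n t| ≤ (1 / 2 : ℝ) ^ n := by
  have h2 : (0 : ℝ) < 2 ^ n := by positivity
  have h : t - dyadicFloor n t = Int.fract (2 ^ n * t) / 2 ^ n := by
    rw [dyadicFloor, Int.fract]; field_simp
  rw [h, abs_of_nonneg (div_nonneg (Int.fract_nonneg _) h2.le), one_div, inv_pow, ← one_div]
  gcongr
  exact (Int.fract_lt_one _).le

/-- On `[-N, N]`, the increments of `f` between neighbouring dyadic numbers of level `n ≥ n₀` are
at most `q ^ n`. -/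
def DyadicIncrementBound (f : ℝ → ℝ) (q : ℝ) (N n₀ : ℕ) : Prop :=
  ∀ n ≥ n₀, ∀ k : ℤ, |k| ≤ N * 2 ^ n → |f ((k + 1 : ℤ) / 2 ^ n) - f (k / 2 ^ n)| ≤ q ^ n

lemma abs_floor_two_pow_mul_le {N : ℕ} {t : ℝ} (ht : |t| + 1 ≤ N) (n : ℕ) :
    |⌊2 ^ n * t⌋| ≤ (N : ℤ) * 2 ^ n := by
  have h2 : (1 : ℝ) ≤ 2 ^ n := one_le_pow₀ (by norm_num)
  have h1 := Int.floor_le (2 ^ n * t)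
  have h3 := Int.lt_floor_add_one (2 ^ n * t)
  have h4 := abs_le.1 (le_refl |t|)
  have h5 : (|t| + 1) * 2 ^ n ≤ N * 2 ^ n := by gcongr
  rw [← Int.cast_le (R := ℝ)]
  push_cast
  rw [abs_le]
  constructor <;> nlinarith

lemma floor_two_mul (x : ℝ) : ⌊2 * x⌋ = 2 * ⌊x⌋ ∨ ⌊2 * x⌋ = 2 * ⌊x⌋ + 1 := by
  have h1 := Int.floor_le x
  have h2 := Int.lt_floor_add_one x
  have h3 : 2 * ⌊x⌋ ≤ ⌊2 * x⌋ := Int.le_floor.2 (by push_cast; linarith)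
  have h4 : ⌊2 * x⌋ < 2 * ⌊x⌋ + 2 := Int.floor_lt.2 (by push_cast; linarith)
  omega

lemma floor_of_sub_le_one {x y : ℝ} (hxy : x ≤ y) (h : y - x ≤ 1) :
    ⌊y⌋ = ⌊x⌋ ∨ ⌊y⌋ = ⌊x⌋ + 1 := by
  have h1 := Int.floor_mono hxy
  have h2 : ⌊y⌋ < ⌊x⌋ + 2 :=
    Int.floor_lt.2 (by push_cast; linarith [Int.lt_floor_add_one x])
  omega

namespace DyadicIncrementBound

variable {f : ℝ → ℝ} {q : ℝ} {N n₀ : ℕ}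

/-- Refining the level by one either leaves the dyadic floor fixed or moves it by one step of level
`n + 1`. -/
lemma abs_succ_sub_le (hf : DyadicIncrementBound f q N n₀) (hq0 : 0 < q) (hq1 : q < 1) {t : ℝ}
    (ht : |t| + 1 ≤ N) {n : ℕ} (hn : n₀ ≤ n) :
    |f (dyadicFloor n t) - f (dyadicFloor (n + 1) t)| ≤ q ^ n := by
  have e : dyadicFloor n t = ((2 * ⌊2 ^ n * t⌋ : ℤ) : ℝ) / 2 ^ (n + 1) := by
    rw [dyadicFloor, pow_succ]; push_cast; field_simp
  have hfl := floor_two_mul (2 ^ n * t)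
  rw [← mul_assoc, ← pow_succ'] at hfl
  rcases hfl with h | h
  · rw [e, dyadicFloor, h, sub_self, abs_zero]; positivity
  · rw [e, dyadicFloor, h, abs_sub_comm]
    refine (hf (n + 1) (by omega) _ ?_).trans (pow_le_pow_of_le_one hq0.le hq1.le (by omega))
    have := abs_floor_two_pow_mul_le ht n
    rw [abs_mul, pow_succ, abs_two]
    linarith

lemma dist_le_geometric (hf : DyadicIncrementBound f q N n₀) (hq0 : 0 < q) (hq1 : q < 1) {t : ℝ}
    (ht : |t| + 1 ≤ N) (m : ℕ) :
    dist (f (dyadicFloor (m + n₀) t)) (f (dyadicFloor (m + 1 + n₀) t)) ≤ q ^ n₀ * q ^ m := by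
  rw [Real.dist_eq, ← pow_add, add_comm n₀ m, show m + 1 + n₀ = m + n₀ + 1 by ring]
  exact hf.abs_succ_sub_le hq0 hq1 ht (by omega)

lemma exists_tendsto (hf : DyadicIncrementBound f q N n₀) (hq0 : 0 < q) (hq1 : q < 1) {t : ℝ}
    (ht : |t| + 1 ≤ N) : ∃ a, Tendsto (fun n => f (dyadicFloor n t)) atTop (𝓝 a) := by
  obtain ⟨a, ha⟩ := cauchySeq_tendsto_of_complete
    (cauchySeq_of_le_geometric q (q ^ n₀) hq1 (hf.dist_le_geometric hq0 hq1 ht))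
  exact ⟨a, (tendsto_add_atTop_iff_nat n₀).1 ha⟩

lemma abs_sub_limit_le (hf : DyadicIncrementBound f q N n₀) (hq0 : 0 < q) (hq1 : q < 1) {t a : ℝ}
    (ht : |t| + 1 ≤ N) (ha : Tendsto (fun n => f (dyadicFloor n t)) atTop (𝓝 a)) {n : ℕ}
    (hn : n₀ ≤ n) : |f (dyadicFloor n t) - a| ≤ q ^ n / (1 - q) := by
  obtain ⟨m, rfl⟩ := Nat.exists_eq_add_of_le' hn
  have := dist_le_of_le_geometric_of_tendsto q (q ^ n₀) hq1 (hf.dist_le_geometric hq0 hq1 ht)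
    ((tendsto_add_atTop_iff_nat n₀).2 ha) m
  rwa [Real.dist_eq, ← pow_add, add_comm n₀ m] at this

lemma abs_limit_sub_le {θ : ℝ} (hθ : 0 < θ) (hf : DyadicIncrementBound f ((1 / 2) ^ θ) N n₀)
    {z : ℝ → ℝ} (hz : ∀ t, Tendsto (fun n => f (dyadicFloor n t)) atTop (𝓝 (z t))) {s t : ℝ}
    (hs : |s| + 1 ≤ N) (ht : |t| + 1 ≤ N) (hst : |t - s| ≤ (1 / 2) ^ n₀) :
    |z t - z s| ≤ (2 / (1 - (1 / 2) ^ θ) + 1) * 2 ^ θ * |t - s| ^ θ := by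
  wlog hle : s ≤ t generalizing s t
  · rw [abs_sub_comm, abs_sub_comm t s]
    exact this ht hs (by rwa [abs_sub_comm]) (le_of_not_ge hle)
  have hq0 : (0 : ℝ) < (1 / 2) ^ θ := by positivity
  have hq1 : (1 / 2 : ℝ) ^ θ < 1 := Real.rpow_lt_one (by norm_num) (by norm_num) hθ
  set q : ℝ := (1 / 2) ^ θ with hq
  have hq1' : 0 < 1 - q := by linarith
  rcases hle.eq_or_lt with rfl | hlt
  · rw [sub_self, abs_zero]; positivity
  rw [abs_of_pos (sub_pos.2 hlt)] at hst ⊢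
  -- At the scale `2 ^ (-(n + 1)) < t - s ≤ 2 ^ (-n)`, the two dyadic floors are equal or adjacent.
  -- The lower bound later turns `q ^ n` into `2 ^ θ * (t - s) ^ θ`.
  obtain ⟨n, hn1, hn2⟩ := exists_nat_pow_near_of_lt_one (sub_pos.2 hlt)
    (hst.trans (pow_le_one₀ (by norm_num) (by norm_num))) (y := (1 / 2 : ℝ))
    (by norm_num) (by norm_num)
  have hn : n₀ ≤ n := by
    by_contra! h
    have : (1 / 2 : ℝ) ^ n₀ ≤ (1 / 2) ^ (n + 1) :=
      pow_le_pow_of_le_one (by norm_num) (by norm_num) h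
    linarith
  have h2n : (0 : ℝ) < 2 ^ n := by positivity
  have hmid : |f (dyadicFloor n t) - f (dyadicFloor n s)| ≤ q ^ n := by
    have hfl := floor_of_sub_le_one (x := 2 ^ n * s) (y := 2 ^ n * t) (by gcongr) (by
      rw [← mul_sub]
      calc 2 ^ n * (t - s) ≤ 2 ^ n * (1 / 2 : ℝ) ^ n := by gcongr
        _ = 1 := by rw [← mul_pow]; norm_num)
    rcases hfl with h | h
    · rw [dyadicFloor, h, dyadicFloor, sub_self, abs_zero]; positivity
    · rw [dyadicFloor, h, dyadicFloor]
      exact hf n hn _ (abs_floor_two_pow_mul_le hs n)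
  have ht' := hf.abs_sub_limit_le hq0 hq1 ht (hz t) hn
  have hs' := hf.abs_sub_limit_le hq0 hq1 hs (hz s) hn
  have hpow : q ^ n ≤ 2 ^ θ * (t - s) ^ θ := by
    rw [hq, ← Real.rpow_natCast, ← Real.rpow_mul (by norm_num), mul_comm θ,
      Real.rpow_mul (by norm_num), Real.rpow_natCast, ← Real.mul_rpow (by norm_num) (by linarith)]
    refine Real.rpow_le_rpow (by positivity) ?_ hθ.le
    rw [pow_succ] at hn1
    linarith
  calc |z t - z s|
      ≤ |f (dyadicFloor n t) - z t| + |f (dyadicFloor n t) - f (dyadicFloor n s)| +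
        |f (dyadicFloor n s) - z s| := by
        have h1 := abs_sub_le (z t) (f (dyadicFloor n t)) (z s)
        have h2 := abs_sub_le (f (dyadicFloor n t)) (f (dyadicFloor n s)) (z s)
        rw [abs_sub_comm (z t) (f _)] at h1
        linarith
    _ ≤ q ^ n / (1 - q) + q ^ n + q ^ n / (1 - q) := by gcongr
    _ = (2 / (1 - q) + 1) * q ^ n := by ring
    _ ≤ (2 / (1 - q) + 1) * (2 ^ θ * (t - s) ^ θ) := by gcongr
    _ = _ := by ring

end DyadicIncrementBound

/-! ### From local increment bounds to continuity and Hölder conditions on intervals. -/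

lemma continuous_of_abs_sub_le_rpow {z : ℝ → ℝ} {η : ℝ} (hη : 0 < η)
    (h : ∀ N : ℕ, ∃ δ > 0, ∃ C : ℝ, ∀ s t : ℝ, |s| ≤ N → |t| ≤ N → |t - s| ≤ δ →
      |z t - z s| ≤ C * |t - s| ^ η) : Continuous z := by
  rw [continuous_iff_continuousAt]
  intro s
  obtain ⟨N, hN⟩ := exists_nat_gt (|s| + 1)
  obtain ⟨δ, hδ, C, hC⟩ := h N
  have hlim : Tendsto (fun t => C * |t - s| ^ η) (𝓝 s) (𝓝 0) := by
    have : Continuous fun t => C * |t - s| ^ η :=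
      continuous_const.mul ((continuous_id.sub continuous_const).abs.rpow_const
        fun _ => .inr hη.le)
    simpa [Real.zero_rpow hη.ne'] using this.tendsto s
  refine tendsto_iff_dist_tendsto_zero.2 (squeeze_zero' (by simp) ?_ hlim)
  filter_upwards [Metric.closedBall_mem_nhds s (lt_min hδ one_pos)] with t ht
  rw [Metric.mem_closedBall, Real.dist_eq, le_min_iff] at ht
  have := abs_sub_abs_le_abs_sub t s
  exact hC s t (by linarith) (by linarith [ht.2]) ht.1

lemma exists_holderOnWith_Icc {z : ℝ → ℝ} (hz : Continuous z) {η δ C : ℝ} {θ : ℝ≥0}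
    (hθη : (θ : ℝ) ≤ η) (hδ : 0 < δ) (a b : ℝ)
    (h : ∀ s ∈ Set.Icc a b, ∀ t ∈ Set.Icc a b, |t - s| ≤ δ → |z t - z s| ≤ C * |t - s| ^ η) :
    ∃ K : ℝ≥0, HolderOnWith K θ z (Set.Icc a b) := by
  obtain ⟨B, hB⟩ := isCompact_Icc.exists_bound_of_continuousOn (hz.continuousOn (s := Set.Icc a b))
  -- The cap at `1` allows lowering the exponent from `η` to `θ`; pairs farther apart than `ε` are
  -- handled by boundedness of `z` on the interval.
  set ε := min δ 1
  have hε : 0 < ε := lt_min hδ one_pos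
  set K := max |C| (2 * |B| / ε ^ (θ : ℝ)) with hK
  have hK0 : 0 ≤ K := (abs_nonneg C).trans (le_max_left _ _)
  have main : ∀ s ∈ Set.Icc a b, ∀ t ∈ Set.Icc a b, |z t - z s| ≤ K * |t - s| ^ (θ : ℝ) := by
    intro s hs t ht
    rcases le_total |t - s| ε with hle | hle
    · refine (h s hs t ht (hle.trans (min_le_left _ _))).trans ?_
      refine mul_le_mul ((le_abs_self C).trans (le_max_left _ _)) ?_ (by positivity) hK0
      rcases (abs_nonneg (t - s)).eq_or_lt with h0 | h0
      · rw [sub_eq_zero.1 (abs_eq_zero.1 h0.symm)]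
        rw [sub_self, abs_zero]
        rcases θ.2.eq_or_lt with hθ | hθ
        · have hθ' : (θ : ℝ) = 0 := hθ.symm
          rw [hθ', Real.rpow_zero]
          exact Real.zero_rpow_le_one _
        · have hθ' : 0 < (θ : ℝ) := hθ
          rw [Real.zero_rpow (hθ'.trans_le hθη).ne', Real.zero_rpow hθ'.ne']
      · exact Real.rpow_le_rpow_of_exponent_ge h0 (hle.trans (min_le_right _ _)) hθη
    · have h1 := hB s hs
      have h2 := hB t ht
      rw [Real.norm_eq_abs] at h1 h2
      have h3 : ε ^ (θ : ℝ) ≤ |t - s| ^ (θ : ℝ) := Real.rpow_le_rpow hε.le hle θ.2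
      have hεθ : 0 < ε ^ (θ : ℝ) := by positivity
      calc |z t - z s| ≤ 2 * |B| := by
            have := abs_sub (z t) (z s)
            have := le_abs_self B
            linarith
        _ = 2 * |B| / ε ^ (θ : ℝ) * ε ^ (θ : ℝ) := by field_simp
        _ ≤ K * |t - s| ^ (θ : ℝ) := by
          gcongr
          exact le_max_right _ _
  refine ⟨K.toNNReal, fun t ht s hs => ?_⟩
  rw [edist_dist, edist_dist, Real.dist_eq, Real.dist_eq,
    ENNReal.ofReal_rpow_of_nonneg (abs_nonneg _) θ.coe_nonneg, ← ENNReal.ofReal_coe_nnreal,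
    Real.coe_toNNReal _ hK0, ← ENNReal.ofReal_mul hK0]
  exact ENNReal.ofReal_le_ofReal (main s hs t ht)

/-! ### Kolmogorov's criterion with weak-type increments. -/

section

variable {Ω : Type*} [MeasurableSpace Ω] {P : Measure Ω}

/-- The weak-type Kolmogorov condition: increments of `Y` have tails of order `|t - s| ^ lam`. -/
def HasIncrementTailBound (P : Measure Ω) (Y : ℝ → Ω → ℝ) (α lam K δ : ℝ) : Prop :=
  ∀ s t r : ℝ, |t - s| < δ → 0 < r →
    P {ω | r < |Y t ω - Y s ω|} ≤ ENNReal.ofReal (K * |t - s| ^ lam * r ^ (-α))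

lemma IsStableMovingAverage.exists_hasIncrementTailBound [IsProbabilityMeasure P]
    {α : ℝ} (hα : 0 < α) {M : Set ℝ → Ω → ℝ}
    (hM : IsSymStableRandomMeasure α volume P M) {g : ℝ → ℝ} (hg : AEStronglyMeasurable g volume)
    {Y : ℝ → Ω → ℝ} (hY : IsStableMovingAverage α P M g Y) {c lam : ℝ} (hc : 0 < c)
    (hinc : ∀ᶠ h : ℝ in 𝓝 0,
      ∫⁻ x : ℝ, ENNReal.ofReal (|g (h - x) - g (-x)| ^ α) ≤ ENNReal.ofReal (c * |h| ^ lam)) :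
    ∃ K ≥ 0, ∃ δ > 0, HasIncrementTailBound P Y α lam K δ := by
  obtain ⟨δ, hδ, hδinc⟩ := Metric.eventually_nhds_iff.1 hinc
  set L := ENNReal.LpAddConst (ENNReal.ofReal α) with hL
  have hLtop : (L * L) ^ α ≠ ∞ := ENNReal.rpow_ne_top_of_nonneg hα.le
    (ENNReal.mul_ne_top (ENNReal.LpAddConst_lt_top _).ne (ENNReal.LpAddConst_lt_top _).ne)
  refine ⟨2 * 2 ^ α * 2 ^ α * ((L * L) ^ α).toReal * c, by positivity, δ, hδ, ?_⟩
  intro s t r hst hr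
  have hmeas : ∀ t : ℝ, AEStronglyMeasurable (fun x => g (t - x)) volume := fun t =>
    hg.comp_quasiMeasurePreserving (quasiMeasurePreserving_sub_left volume t)
  have hD : eLpNorm (fun x => g (t - x) - g (s - x)) (ENNReal.ofReal α) volume ^ α ≤
      ENNReal.ofReal (c * |t - s| ^ lam) := by
    -- Translating `x` by `s` reduces the increment from `s` to `t` to the one from `0` to `t - s`.
    rw [eLpNorm_ofReal_rpow hα, ← lintegral_add_right_eq_self _ s]
    refine le_trans (le_of_eq (lintegral_congr fun x => ?_))
      (hδinc (y := t - s) (by simpa [Real.dist_eq] using hst))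
    rw [show t - (x + s) = t - s - x by ring, show s - (x + s) = -x by ring]
  refine (IsStableIntegral.measure_abs_sub_gt_le hM hα (hmeas t) (hmeas s) (hY t) (hY s)
    hr).trans ?_
  rw [← mul_assoc, ENNReal.mul_rpow_of_nonneg _ _ hα.le, ← ENNReal.ofReal_toReal hLtop]
  refine (mul_le_mul' le_rfl (mul_le_mul' le_rfl hD)).trans_eq ?_
  rw [← ENNReal.ofReal_mul (by positivity), ← ENNReal.ofReal_mul (by positivity)]
  congr 1
  rw [Real.div_rpow hr.le (by norm_num), Real.rpow_neg (by norm_num : (0 : ℝ) ≤ 2),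
    ENNReal.toReal_ofReal ENNReal.toReal_nonneg]
  field_simp

variable {Y : ℝ → Ω → ℝ} {α lam K δ : ℝ}

/-- Union bound over at most `(2 * N + 1) * 2 ^ n` increments, each of length `2 ^ (-n)`. -/
lemma HasIncrementTailBound.measure_exists_dyadic_gt_le (h : HasIncrementTailBound P Y α lam K δ)
    (hK : 0 ≤ K) (θ : ℝ) (N n : ℕ) (hn : (1 / 2 : ℝ) ^ n < δ) :
    P {ω | ∃ k : ℤ, |k| ≤ N * 2 ^ n ∧
      ((1 / 2 : ℝ) ^ θ) ^ n < |Y ((k + 1 : ℤ) / 2 ^ n) ω - Y (k / 2 ^ n) ω|} ≤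
      ENNReal.ofReal ((2 * N + 1) * K * (2 ^ (1 - lam + θ * α)) ^ n) := by
  set S := Finset.Icc (-((N : ℤ) * 2 ^ n)) (N * 2 ^ n) with hS
  have hcard : (S.card : ℝ) ≤ (2 * N + 1) * 2 ^ n := by
    have : (S.card : ℤ) = 2 * (N * 2 ^ n) + 1 := by
      rw [hS, Int.card_Icc, sub_neg_eq_add, Int.toNat_of_nonneg (by positivity)]; ring
    have : (S.card : ℝ) = 2 * (N * 2 ^ n) + 1 := by exact_mod_cast this
    rw [this]
    nlinarith [one_le_pow₀ (n := n) (by norm_num : (1 : ℝ) ≤ 2)]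
  have hsub : {ω | ∃ k : ℤ, |k| ≤ N * 2 ^ n ∧
      ((1 / 2 : ℝ) ^ θ) ^ n < |Y ((k + 1 : ℤ) / 2 ^ n) ω - Y (k / 2 ^ n) ω|} ⊆
      ⋃ k ∈ S, {ω | ((1 / 2 : ℝ) ^ θ) ^ n < |Y ((k + 1 : ℤ) / 2 ^ n) ω - Y (k / 2 ^ n) ω|} := by
    rintro ω ⟨k, hk, hω⟩
    simp only [Set.mem_iUnion]
    exact ⟨k, Finset.mem_Icc.2 (abs_le.1 hk), hω⟩
  have hterm : ∀ k ∈ S,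
      P {ω | ((1 / 2 : ℝ) ^ θ) ^ n < |Y ((k + 1 : ℤ) / 2 ^ n) ω - Y (k / 2 ^ n) ω|} ≤
        ENNReal.ofReal (K * ((1 / 2) ^ n) ^ lam * (((1 / 2 : ℝ) ^ θ) ^ n) ^ (-α)) := by
    intro k _
    have e : |((k + 1 : ℤ) : ℝ) / 2 ^ n - k / 2 ^ n| = (1 / 2) ^ n := by
      rw [← sub_div]
      push_cast
      rw [add_sub_cancel_left, abs_of_pos (by positivity), div_pow, one_pow]
    simpa only [e] using h (k / 2 ^ n) ((k + 1 : ℤ) / 2 ^ n) (((1 / 2 : ℝ) ^ θ) ^ n)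
      (by rwa [e]) (by positivity)
  refine (measure_mono hsub).trans ((measure_biUnion_finset_le _ _).trans
    ((Finset.sum_le_sum hterm).trans ?_))
  rw [Finset.sum_const, nsmul_eq_mul, ← ENNReal.ofReal_natCast,
    ← ENNReal.ofReal_mul (Nat.cast_nonneg _)]
  refine ENNReal.ofReal_le_ofReal ?_
  have e1 : (2 : ℝ) ^ n * ((1 / 2 : ℝ) ^ n) ^ lam * (((1 / 2 : ℝ) ^ θ) ^ n) ^ (-α) =
      (2 ^ (1 - lam + θ * α)) ^ n := by
    have h2 : (0 : ℝ) < 2 := by norm_num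
    have hhalf : (1 / 2 : ℝ) = 2 ^ (-1 : ℝ) := by rw [Real.rpow_neg_one]; norm_num
    rw [hhalf]
    simp only [← Real.rpow_natCast, ← Real.rpow_mul h2.le, ← Real.rpow_add h2]
    congr 1
    ring
  calc (S.card : ℝ) * (K * ((1 / 2) ^ n) ^ lam * (((1 / 2 : ℝ) ^ θ) ^ n) ^ (-α))
      ≤ ((2 * N + 1) * 2 ^ n) * (K * ((1 / 2) ^ n) ^ lam * (((1 / 2 : ℝ) ^ θ) ^ n) ^ (-α)) := by
        gcongr
    _ = (2 * N + 1) * K *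
        (2 ^ n * ((1 / 2) ^ n) ^ lam * (((1 / 2 : ℝ) ^ θ) ^ n) ^ (-α)) := by ring
    _ = _ := by rw [e1]

lemma HasIncrementTailBound.ae_exists_dyadicIncrementBound
    (h : HasIncrementTailBound P Y α lam K δ) (hK : 0 ≤ K) (hδ : 0 < δ) (hα : 0 < α) {θ : ℝ}
    (hθ : θ < (lam - 1) / α) (N : ℕ) :
    ∀ᵐ ω ∂P, ∃ n₀, DyadicIncrementBound (fun t => Y t ω) ((1 / 2) ^ θ) N n₀ := by
  obtain ⟨n₁, hn₁⟩ := exists_pow_lt_of_lt_one hδ (by norm_num : (1 / 2 : ℝ) < 1)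
  set ρ : ℝ := 2 ^ (1 - lam + θ * α) with hρ
  have hρ0 : 0 < ρ := by positivity
  have hρ1 : ρ < 1 := by
    rw [lt_div_iff₀ hα] at hθ
    exact Real.rpow_lt_one_of_one_lt_of_neg (by norm_num) (by linarith)
  have hsum : Summable fun n : ℕ => (2 * N + 1) * K * ρ ^ (n + n₁) :=
    ((summable_nat_add_iff n₁).2 (summable_geometric_of_lt_one hρ0.le hρ1)).mul_left _
  have hfin : ∑' n, P {ω | ∃ k : ℤ, |k| ≤ N * 2 ^ (n + n₁) ∧ ((1 / 2 : ℝ) ^ θ) ^ (n + n₁) <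
      |Y ((k + 1 : ℤ) / 2 ^ (n + n₁)) ω - Y (k / 2 ^ (n + n₁)) ω|} ≠ ∞ := by
    refine ne_top_of_le_ne_top hsum.tsum_ofReal_ne_top (ENNReal.tsum_le_tsum fun n => ?_)
    refine h.measure_exists_dyadic_gt_le hK θ N (n + n₁) (lt_of_le_of_lt ?_ hn₁)
    exact pow_le_pow_of_le_one (by norm_num) (by norm_num) (by omega)
  filter_upwards [ae_eventually_notMem hfin] with ω hω
  obtain ⟨m, hm⟩ := eventually_atTop.1 hω
  refine ⟨m + n₁, fun n hn k hk => ?_⟩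
  obtain ⟨j, rfl⟩ := Nat.exists_eq_add_of_le' (show n₁ ≤ n by omega)
  have := hm j (by omega)
  simp only [not_exists, not_and, not_lt] at this
  exact this k hk

/-- Identifies the pathwise dyadic limit with `Y t` almost surely, limits in probability being
unique. -/
lemma HasIncrementTailBound.tendstoInMeasure_dyadicFloor
    (h : HasIncrementTailBound P Y α lam K δ) (hδ : 0 < δ) (hlam : 0 < lam) (t : ℝ) :
    TendstoInMeasure P (fun n => Y (dyadicFloor n t)) atTop (Y t) := by
  rw [tendstoInMeasure_iff_norm]
  intro ε hε
  have hd : Tendsto (fun n => |dyadicFloor n t - t|) atTop (𝓝 0) :=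
    squeeze_zero (fun _ => abs_nonneg _)
      (fun n => (abs_sub_comm _ _).trans_le (abs_sub_dyadicFloor_le n t))
      (tendsto_pow_atTop_nhds_zero_of_lt_one (by norm_num) (by norm_num))
  have hlim : Tendsto
      (fun n => ENNReal.ofReal (K * |dyadicFloor n t - t| ^ lam * (ε / 2) ^ (-α))) atTop (𝓝 0) := by
    have h1 := ((hd.rpow_const (p := lam) (.inr hlam.le)).const_mul K).mul_const ((ε / 2) ^ (-α))
    rw [Real.zero_rpow hlam.ne', mul_zero, zero_mul] at h1
    simpa using ENNReal.tendsto_ofReal h1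
  refine tendsto_of_tendsto_of_tendsto_of_le_of_le' tendsto_const_nhds hlim
    (Eventually.of_forall fun _ => bot_le) ?_
  filter_upwards [hd.eventually_lt_const hδ] with n hn
  refine (measure_mono fun ω hω => ?_).trans (h t (dyadicFloor n t) (ε / 2) hn (half_pos hε))
  exact (half_lt_self hε).trans_le hω

/-- A continuity theorem of Kolmogorov type under a weak-type condition on the increments. -/
lemma HasIncrementTailBound.exists_holder_modification [IsProbabilityMeasure P]
    (h : HasIncrementTailBound P Y α lam K δ) (hY : ∀ t, Measurable (Y t)) (hK : 0 ≤ K)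
    (hδ : 0 < δ) (hα : 0 < α) (hlam : 1 < lam) :
    ∃ Z : ℝ → Ω → ℝ,
      (∀ t, Measurable (Z t)) ∧
      (∀ t, Z t =ᵐ[P] Y t) ∧
      (∀ ω, Continuous (fun t => Z t ω)) ∧
      (∀ ω, ∀ θ : ℝ≥0, (θ : ℝ) < (lam - 1) / α → ∀ a b : ℝ, ∃ C : ℝ≥0,
        HolderOnWith C θ (fun t => Z t ω) (Set.Icc a b)) := by
  have hγ : 0 < (lam - 1) / α := div_pos (by linarith) hα
  obtain ⟨v, -, hv, hvlim⟩ := exists_seq_strictMono_tendsto' hγ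
  have hae : ∀ᵐ ω ∂P, ∀ j N : ℕ,
      ∃ n₀, DyadicIncrementBound (fun t => Y t ω) ((1 / 2) ^ v j) N n₀ := by
    simp only [ae_all_iff]
    exact fun j N => h.ae_exists_dyadicIncrementBound hK hδ hα (hv j).2 N
  obtain ⟨G, hGsub, hGm, hG⟩ := exists_measurable_superset_of_null hae
  have hgood : ∀ ω ∉ G, ∀ j N : ℕ,
      ∃ n₀, DyadicIncrementBound (fun t => Y t ω) ((1 / 2) ^ v j) N n₀ := fun ω hω => by
    by_contra hcon
    exact hω (hGsub hcon)
  -- Setting paths to zero on the measurable null set `G` makes the dyadic bounds hold for every `ω`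
  -- and keeps measurability.
  let Y' : ℝ → Ω → ℝ := fun t => Gᶜ.indicator (Y t)
  have hpath : ∀ ω, ∀ j N : ℕ,
      ∃ n₀, DyadicIncrementBound (fun t => Y' t ω) ((1 / 2) ^ v j) N n₀ := by
    intro ω j N
    by_cases hω : ω ∈ G
    · refine ⟨0, fun n _ k _ => ?_⟩
      simp only [Y', Set.indicator_of_notMem (show ω ∉ Gᶜ from fun hn => hn hω), sub_self, abs_zero]
      positivity
    · simpa only [Y', Set.indicator_of_mem (show ω ∈ Gᶜ from hω)] using hgood ω hω j N
  have hconv : ∀ (t : ℝ) ω, ∃ a, Tendsto (fun n => Y' (dyadicFloor n t) ω) atTop (𝓝 a) := by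
    intro t ω
    obtain ⟨N, hN⟩ := exists_nat_ge (|t| + 1)
    obtain ⟨n₀, hn₀⟩ := hpath ω 0 N
    exact hn₀.exists_tendsto (by positivity)
      (Real.rpow_lt_one (by norm_num) (by norm_num) (hv 0).1) hN
  choose Z hZ using hconv
  have hloc : ∀ ω, ∀ j N : ℕ, ∃ δ > 0, ∃ C : ℝ, ∀ s t : ℝ, |s| ≤ N → |t| ≤ N → |t - s| ≤ δ →
      |Z t ω - Z s ω| ≤ C * |t - s| ^ v j := by
    intro ω j N
    obtain ⟨n₀, hn₀⟩ := hpath ω j (N + 1)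
    refine ⟨(1 / 2) ^ n₀, by positivity, _, fun s t hs ht hst =>
      hn₀.abs_limit_sub_le (hv j).1 (z := fun t => Z t ω) (fun t => hZ t ω) ?_ ?_ hst⟩ <;>
    · push_cast; linarith
  have hcont : ∀ ω, Continuous (fun t => Z t ω) := fun ω =>
    continuous_of_abs_sub_le_rpow (hv 0).1 (hloc ω 0)
  have hGae : ∀ᵐ ω ∂P, ω ∉ G := measure_eq_zero_iff_ae_notMem.1 hG
  refine ⟨Z, fun t => ?_, fun t => ?_, hcont, fun ω θ hθ a b => ?_⟩
  · exact measurable_of_tendsto_metrizable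
      (fun n => (hY (dyadicFloor n t)).indicator hGm.compl) (tendsto_pi_nhds.2 fun ω => hZ t ω)
  · have h1 : TendstoInMeasure P (fun n => Y (dyadicFloor n t)) atTop (Z t) := by
      refine tendstoInMeasure_of_tendsto_ae (fun n => (hY _).aestronglyMeasurable) ?_
      filter_upwards [hGae] with ω hω
      simpa only [Y', Set.indicator_of_mem (show ω ∈ Gᶜ from hω)] using hZ t ω
    exact tendstoInMeasure_ae_unique h1 (h.tendstoInMeasure_dyadicFloor hδ (by linarith) t)
  · obtain ⟨j, hj⟩ := (hvlim.eventually_const_lt hθ).exists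
    obtain ⟨N, hN⟩ := exists_nat_ge (max |a| |b|)
    obtain ⟨ε, hε, C, hC⟩ := hloc ω j N
    have hmem : ∀ s ∈ Set.Icc a b, |s| ≤ N := fun s hs =>
      (abs_le_max_abs_abs hs.1 hs.2).trans hN
    exact exists_holderOnWith_Icc (hcont ω) hj.le hε a b
      fun s hs t ht => hC s t (hmem s hs) (hmem t ht)

end

theorem proposition2p3 {Ω : Type*} [MeasurableSpace Ω] (P : Measure Ω) [IsProbabilityMeasure P]
    (α : ℝ) (hα0 : 0 < α) (hα2 : α < 2)
    (M : Set ℝ → Ω → ℝ) (hM : IsSymStableRandomMeasure α volume P M)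
    (g : ℝ → ℝ) (hg : MemLp g (ENNReal.ofReal α) volume)
    (Y : ℝ → Ω → ℝ) (hY : IsStableMovingAverage α P M g Y)
    (c lam : ℝ) (hc : 0 < c) (hlam : 1 < lam)
    (hinc : ∀ᶠ h : ℝ in 𝓝 0,
      ∫⁻ x : ℝ, ENNReal.ofReal (|g (h - x) - g (-x)| ^ α) ≤ ENNReal.ofReal (c * |h| ^ lam)) :
    ∃ Z : ℝ → Ω → ℝ,
      (∀ t, Measurable (Z t)) ∧
      (∀ t, Z t =ᵐ[P] Y t) ∧
      (∀ ω, Continuous (fun t => Z t ω)) ∧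
      (∀ ω, ∀ θ : ℝ≥0, (θ : ℝ) < (lam - 1) / α → ∀ a b : ℝ, ∃ C : ℝ≥0,
        HolderOnWith C θ (fun t => Z t ω) (Set.Icc a b)) := by
  obtain ⟨K, hK, δ, hδ, hbound⟩ :=
    hY.exists_hasIncrementTailBound hα0 hM hg.aestronglyMeasurable hc hinc
  exact hbound.exists_holder_modification (fun t => (hY t).1) hK hδ hα0 hlam
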